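/- Let $d\ge 1$. For an open set $\Omega\subseteq\mathbb R^d$ let $\mathcal G(\Omega)=\mathcal E_M(\Omega)/\mathcal N(\Omega)$ be the special Colombeau algebra: $\mathcal E_M(\Omega)$ is the algebra of nets $(u_\varepsilon)_{\varepsilon\in(0,1]}$ of complex-valued $C^\infty$ functions on $\Omega$ such that for every compact $K\subseteq\Omega$ and every $\beta\in\mathbb N_0^d$ there is $N\ge 0$ with $\sup_{x\in K}|\partial^\beta u_\varepsilon(x)|=O(\varepsilon^{-N})$ as $\varepsilon\to 0$, and $\mathcal N(\Omega)$ is the ideal of those nets such that for every compact $K\subseteq\Omega$, every $\beta\in\mathbb N_0^d$ and every $m\ge 0$ one has $\sup_{x\in K}|\partial^\beta u_\varepsilon(x)|=O(\varepsilon^{m})$ as $\varepsilon\to0$. Restriction to open subsets and the scaling $u(x)\mapsto u(\lambda x)$ (for $\lambda>0$, where $\Omega$ is $\mathbb R^d$ or $\mathbb R^d\setminus\{0\}$) are defined on representatives. An element $u$ of $\mathcal G(\mathbb R^d)$ (resp. $\mathcal G(\mathbb R^d\setminus\{0\})$) is called homogeneous of degree $\alpha\in\mathbb R$ if for each real $\lambda>0$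 the equality $u(\lambda x)=\lambda^\alpha u(x)$ holds in $\mathcal G(\mathbb R^d)$ (resp. $\mathcal G(\mathbb R^d\setminus\{0\})$). **Theorem.** Let $\alpha\in\mathbb R$ and let $u\in\mathcal G(\mathbb R^d\setminus\{0\})$, $u\ne 0$, be homogeneous of degree $\alpha$. 1. $u$ is extendable: there exists $\hat u\in\mathcal G(\mathbb R^d)$ with $\hat u|_{\mathbb R^d\setminus\{0\}}=u$ in $\mathcal G(\mathbb R^d\setminus\{0\})$. 2. If $u$ is extendable as a homogeneous function, that is, if there exist $\beta\in\mathbb R$ and $\hat u\in\mathcal G(\mathbb R^d)$ homogeneous of degree $\beta$ with $\hat u|_{\mathbb R^d\setminus\{0\}}=u$ in $\mathcal G(\mathbb R^d\setminus\{0\})$, then $\alpha\in\mathbb N_0$. -/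

import Mathlib

open scoped ContDiff

namespace Colombeau

/-- Nets `(u_ε)` of complex valued functions on `ℝ^d`, indexed by `ε ∈ (0,1]`. Below, such a net
represents a net of functions on an open set `Ω`: only its values on `Ω` matter. -/
abbrev Net (d : ℕ) : Type := Set.Ioc (0 : ℝ) 1 → EuclideanSpace ℝ (Fin d) → ℂ

/-- `sup_{x ∈ K} φ_ε(x) = O(ε^m)` as `ε → 0`. -/
def SupIsBigO {X : Type*} (K : Set X) (φ : Set.Ioc (0 : ℝ) 1 → X → ℝ) (m : ℤ) : Prop :=
  ∃ C : ℝ, ∃ η : ℝ, 0 < η ∧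
    ∀ ε : Set.Ioc (0 : ℝ) 1, (ε : ℝ) < η → ∀ x ∈ K, φ ε x ≤ C * (ε : ℝ) ^ m

namespace SupIsBigO

variable {X : Type*} {K : Set X} {φ ψ : Set.Ioc (0 : ℝ) 1 → X → ℝ} {m n : ℤ}

lemma anti (h : SupIsBigO K φ m) (hnm : n ≤ m) : SupIsBigO K φ n := by
  obtain ⟨C, η, hη, h⟩ := h
  refine ⟨|C|, η, hη, fun ε hε x hx => (h ε hε x hx).trans ?_⟩
  have h0 : (0 : ℝ) < ε := ε.2.1
  have h1 : (ε : ℝ) ^ m ≤ (ε : ℝ) ^ n := zpow_le_zpow_right_of_le_one₀ h0 ε.2.2 hnm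
  exact mul_le_mul (le_abs_self C) h1 (zpow_pos h0 m).le (abs_nonneg C)

lemma le (h : SupIsBigO K φ m) (hψ : ∀ ε, ∀ x ∈ K, ψ ε x ≤ φ ε x) : SupIsBigO K ψ m := by
  obtain ⟨C, η, hη, h⟩ := h
  exact ⟨C, η, hη, fun ε hε x hx => (hψ ε x hx).trans (h ε hε x hx)⟩

lemma add (hφ : SupIsBigO K φ m) (hψ : SupIsBigO K ψ m) :
    SupIsBigO K (fun ε x => φ ε x + ψ ε x) m := by
  obtain ⟨C, η, hη, h⟩ := hφ
  obtain ⟨C', η', hη', h'⟩ := hψ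
  refine ⟨C + C', min η η', lt_min hη hη', fun ε hε x hx => ?_⟩
  rw [add_mul]
  exact add_le_add (h ε (hε.trans_le (min_le_left _ _)) x hx)
    (h' ε (hε.trans_le (min_le_right _ _)) x hx)

lemma mul (hφ : SupIsBigO K φ m) (hψ : SupIsBigO K ψ n)
    (hφ0 : ∀ ε x, 0 ≤ φ ε x) (hψ0 : ∀ ε x, 0 ≤ ψ ε x) :
    SupIsBigO K (fun ε x => φ ε x * ψ ε x) (m + n) := by
  obtain ⟨C, η, hη, h⟩ := hφ
  obtain ⟨C', η', hη', h'⟩ := hψ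
  refine ⟨C * C', min η η', lt_min hη hη', fun ε hε x hx => ?_⟩
  have h1 := h ε (hε.trans_le (min_le_left _ _)) x hx
  have h2 := h' ε (hε.trans_le (min_le_right _ _)) x hx
  have h0 : (ε : ℝ) ≠ 0 := ε.2.1.ne'
  calc φ ε x * ψ ε x ≤ (C * (ε : ℝ) ^ m) * (C' * (ε : ℝ) ^ n) :=
        mul_le_mul h1 h2 (hψ0 ε x) ((hφ0 ε x).trans h1)
    _ = C * C' * (ε : ℝ) ^ (m + n) := by rw [zpow_add₀ h0]; ring

lemma const_mul {c : ℝ} (hc : 0 ≤ c) (hφ : SupIsBigO K φ m) :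
    SupIsBigO K (fun ε x => c * φ ε x) m := by
  obtain ⟨C, η, hη, h⟩ := hφ
  refine ⟨c * C, η, hη, fun ε hε x hx => ?_⟩
  rw [mul_assoc]
  exact mul_le_mul_of_nonneg_left (h ε hε x hx) hc

lemma zero : SupIsBigO K (fun _ _ => 0) m := ⟨0, 1, one_pos, fun _ _ _ _ => by simp⟩

lemma sum {ι : Type*} {s : Finset ι} {Φ : ι → Set.Ioc (0 : ℝ) 1 → X → ℝ}
    (h : ∀ i ∈ s, SupIsBigO K (Φ i) m) : SupIsBigO K (fun ε x => ∑ i ∈ s, Φ i ε x) m := by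
  classical
  induction s using Finset.induction_on with
  | empty => simpa using zero
  | insert a s ha ih =>
    simp only [Finset.sum_insert ha]
    exact (h a (Finset.mem_insert_self _ _)).add
      (ih fun i hi => h i (Finset.mem_insert_of_mem hi))

lemma sum_of_exists {ι : Type*} {s : Finset ι} {Φ : ι → Set.Ioc (0 : ℝ) 1 → X → ℝ}
    (h : ∀ i ∈ s, ∃ N : ℕ, SupIsBigO K (Φ i) (-(N : ℤ))) :
    ∃ N : ℕ, SupIsBigO K (fun ε x => ∑ i ∈ s, Φ i ε x) (-(N : ℤ)) := by
  choose! N hN using h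
  refine ⟨∑ i ∈ s, N i, sum fun i hi => (hN i hi).anti ?_⟩
  have : N i ≤ ∑ i ∈ s, N i := Finset.single_le_sum (fun _ _ => Nat.zero_le _) hi
  omega

end SupIsBigO

section

variable {d : ℕ}

/-- Every member of the net is of class `C^∞` on `Ω`. -/
def IsSmooth (Ω : TopologicalSpace.Opens (EuclideanSpace ℝ (Fin d))) (u : Net d) : Prop :=
  ∀ ε, ContDiffOn ℝ ∞ (u ε) Ω

/-- Moderateness on `Ω`: for all compact `K ⊆ Ω` and all orders `k` there is `N` such that the
derivatives of order `k` of `u_ε` are `O(ε^(-N))`, uniformly on `K`. (The norm of the `k`-th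
derivative is equivalent to the maximum of the moduli of all partial derivatives of order `k`.) -/
def IsModerate (Ω : TopologicalSpace.Opens (EuclideanSpace ℝ (Fin d))) (u : Net d) : Prop :=
  ∀ K : Set (EuclideanSpace ℝ (Fin d)), IsCompact K → K ⊆ Ω → ∀ k : ℕ, ∃ N : ℕ,
    SupIsBigO K (fun ε x => ‖iteratedFDeriv ℝ k (u ε) x‖) (-(N : ℤ))

/-- Negligibility on `Ω`: for all compact `K ⊆ Ω`, all orders `k` and all `m`, the derivatives of
order `k` of `u_ε` are `O(ε^m)`, uniformly on `K`. -/
def IsNegligible (Ω : TopologicalSpace.Opens (EuclideanSpace ℝ (Fin d))) (u : Net d) : Prop :=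
  ∀ K : Set (EuclideanSpace ℝ (Fin d)), IsCompact K → K ⊆ Ω → ∀ k : ℕ, ∀ m : ℕ,
    SupIsBigO K (fun ε x => ‖iteratedFDeriv ℝ k (u ε) x‖) (m : ℤ)

variable {Ω Ω' : TopologicalSpace.Opens (EuclideanSpace ℝ (Fin d))} {u v : Net d}

lemma norm_iteratedFDeriv_add_le (hu : IsSmooth Ω u) (hv : IsSmooth Ω v) (k : ℕ)
    (ε : Set.Ioc (0 : ℝ) 1) {x : EuclideanSpace ℝ (Fin d)} (hx : x ∈ Ω) :
    ‖iteratedFDeriv ℝ k ((u + v) ε) x‖ ≤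
      ‖iteratedFDeriv ℝ k (u ε) x‖ + ‖iteratedFDeriv ℝ k (v ε) x‖ := by
  have h1 : ContDiffAt ℝ k (u ε) x :=
    ((hu ε).contDiffAt (Ω.isOpen.mem_nhds hx)).of_le (by exact_mod_cast le_top)
  have h2 : ContDiffAt ℝ k (v ε) x :=
    ((hv ε).contDiffAt (Ω.isOpen.mem_nhds hx)).of_le (by exact_mod_cast le_top)
  rw [Pi.add_apply, iteratedFDeriv_add_apply h1 h2]
  exact norm_add_le _ _

lemma norm_iteratedFDeriv_mul_le (hu : IsSmooth Ω u) (hv : IsSmooth Ω v) (k : ℕ)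
    (ε : Set.Ioc (0 : ℝ) 1) {x : EuclideanSpace ℝ (Fin d)} (hx : x ∈ Ω) :
    ‖iteratedFDeriv ℝ k ((u * v) ε) x‖ ≤ ∑ i ∈ Finset.range (k + 1), (k.choose i : ℝ) *
      (‖iteratedFDeriv ℝ i (u ε) x‖ * ‖iteratedFDeriv ℝ (k - i) (v ε) x‖) := by
  have h := norm_iteratedFDerivWithin_mul_le (n := k) (hu ε) (hv ε) Ω.isOpen.uniqueDiffOn hx
    (by exact_mod_cast le_top)
  simp only [iteratedFDerivWithin_of_isOpen _ Ω.isOpen hx, mul_assoc] at h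
  exact h

lemma norm_iteratedFDeriv_comp_le (hu : IsSmooth Ω' u)
    (L : EuclideanSpace ℝ (Fin d) →L[ℝ] EuclideanSpace ℝ (Fin d)) (k : ℕ)
    (ε : Set.Ioc (0 : ℝ) 1) {x : EuclideanSpace ℝ (Fin d)} (hx : L x ∈ Ω') :
    ‖iteratedFDeriv ℝ k (fun y => u ε (L y)) x‖ ≤
      ‖L‖ ^ k * ‖iteratedFDeriv ℝ k (u ε) (L x)‖ := by
  have ho : IsOpen (L ⁻¹' (Ω' : Set (EuclideanSpace ℝ (Fin d)))) :=
    Ω'.isOpen.preimage L.continuous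
  have h := L.iteratedFDerivWithin_comp_right (hu ε) Ω'.isOpen.uniqueDiffOn ho.uniqueDiffOn hx
    (i := k) (by exact_mod_cast le_top)
  rw [iteratedFDerivWithin_of_isOpen k ho hx, iteratedFDerivWithin_of_isOpen k Ω'.isOpen hx] at h
  change ‖iteratedFDeriv ℝ k (u ε ∘ L) x‖ ≤ _
  rw [h]
  refine (ContinuousMultilinearMap.norm_compContinuousLinearMap_le _ _).trans ?_
  simp [mul_comm]

lemma IsModerate.add (hu : IsSmooth Ω u) (hv : IsSmooth Ω v) (hu' : IsModerate Ω u)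
    (hv' : IsModerate Ω v) : IsModerate Ω (u + v) := by
  intro K hK hKΩ k
  obtain ⟨N, hN⟩ := hu' K hK hKΩ k
  obtain ⟨N', hN'⟩ := hv' K hK hKΩ k
  exact ⟨max N N', ((hN.anti (by omega)).add (hN'.anti (by omega))).le
    fun ε x hx => norm_iteratedFDeriv_add_le hu hv k ε (hKΩ hx)⟩

lemma IsModerate.mul (hu : IsSmooth Ω u) (hv : IsSmooth Ω v) (hu' : IsModerate Ω u)
    (hv' : IsModerate Ω v) : IsModerate Ω (u * v) := by
  intro K hK hKΩ k
  have key := SupIsBigO.sum_of_exists (K := K) (s := Finset.range (k + 1))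
    (Φ := fun i ε x => (k.choose i : ℝ) *
      (‖iteratedFDeriv ℝ i (u ε) x‖ * ‖iteratedFDeriv ℝ (k - i) (v ε) x‖)) ?_
  · obtain ⟨N, hN⟩ := key
    exact ⟨N, hN.le fun ε x hx => norm_iteratedFDeriv_mul_le hu hv k ε (hKΩ hx)⟩
  · intro i _
    obtain ⟨N, hN⟩ := hu' K hK hKΩ i
    obtain ⟨N', hN'⟩ := hv' K hK hKΩ (k - i)
    exact ⟨N + N', ((hN.mul hN' (fun _ _ => norm_nonneg _)
      (fun _ _ => norm_nonneg _)).anti (by push_cast; omega)).const_mul (Nat.cast_nonneg _)⟩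

lemma IsNegligible.add (hu : IsSmooth Ω u) (hv : IsSmooth Ω v) (hu' : IsNegligible Ω u)
    (hv' : IsNegligible Ω v) : IsNegligible Ω (u + v) := fun K hK hKΩ k m =>
  ((hu' K hK hKΩ k m).add (hv' K hK hKΩ k m)).le
    fun ε _ hx => norm_iteratedFDeriv_add_le hu hv k ε (hKΩ hx)

lemma IsNegligible.mul (hu : IsSmooth Ω u) (hv : IsSmooth Ω v) (hu' : IsModerate Ω u)
    (hv' : IsNegligible Ω v) : IsNegligible Ω (u * v) := by
  intro K hK hKΩ k m
  have key := SupIsBigO.sum (K := K) (m := (m : ℤ)) (s := Finset.range (k + 1))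
    (Φ := fun i ε x => (k.choose i : ℝ) *
      (‖iteratedFDeriv ℝ i (u ε) x‖ * ‖iteratedFDeriv ℝ (k - i) (v ε) x‖)) ?_
  · exact key.le fun ε x hx => norm_iteratedFDeriv_mul_le hu hv k ε (hKΩ hx)
  · intro i _
    obtain ⟨N, hN⟩ := hu' K hK hKΩ i
    exact ((hN.mul (hv' K hK hKΩ (k - i) (m + N)) (fun _ _ => norm_nonneg _)
      (fun _ _ => norm_nonneg _)).anti (by push_cast; omega)).const_mul (Nat.cast_nonneg _)

lemma IsModerate.const (c : ℂ) : IsModerate Ω (fun _ _ => c : Net d) := by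
  intro K _ _ k
  refine ⟨0, ‖c‖, 1, one_pos, fun ε _ x _ => ?_⟩
  rcases Nat.eq_zero_or_pos k with rfl | hk
  · simp
  · simp [iteratedFDeriv_const_of_ne hk.ne']

lemma IsSmooth.comp (hu : IsSmooth Ω' u)
    {L : EuclideanSpace ℝ (Fin d) →L[ℝ] EuclideanSpace ℝ (Fin d)} (hL : Set.MapsTo L Ω Ω') :
    IsSmooth Ω (fun ε x => u ε (L x)) := fun ε =>
  (hu ε).comp L.contDiff.contDiffOn hL

lemma IsModerate.comp (hu : IsSmooth Ω' u) (hu' : IsModerate Ω' u)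
    {L : EuclideanSpace ℝ (Fin d) →L[ℝ] EuclideanSpace ℝ (Fin d)} (hL : Set.MapsTo L Ω Ω') :
    IsModerate Ω (fun ε x => u ε (L x)) := by
  intro K hK hKΩ k
  obtain ⟨N, C, η, hη, h⟩ := hu' (L '' K) (hK.image L.continuous)
    (Set.image_subset_iff.2 fun x hx => hL (hKΩ hx)) k
  have h' : SupIsBigO K (fun ε x => ‖iteratedFDeriv ℝ k (u ε) (L x)‖) (-(N : ℤ)) :=
    ⟨C, η, hη, fun ε hε x hx => h ε hε (L x) (Set.mem_image_of_mem L hx)⟩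
  exact ⟨N, (h'.const_mul (pow_nonneg (norm_nonneg L) k)).le
    fun ε x hx => norm_iteratedFDeriv_comp_le hu L k ε (hL (hKΩ hx))⟩

lemma IsNegligible.comp (hu : IsSmooth Ω' u) (hu' : IsNegligible Ω' u)
    {L : EuclideanSpace ℝ (Fin d) →L[ℝ] EuclideanSpace ℝ (Fin d)} (hL : Set.MapsTo L Ω Ω') :
    IsNegligible Ω (fun ε x => u ε (L x)) := by
  intro K hK hKΩ k m
  obtain ⟨C, η, hη, h⟩ := hu' (L '' K) (hK.image L.continuous)
    (Set.image_subset_iff.2 fun x hx => hL (hKΩ hx)) k m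
  have h' : SupIsBigO K (fun ε x => ‖iteratedFDeriv ℝ k (u ε) (L x)‖) (m : ℤ) :=
    ⟨C, η, hη, fun ε hε x hx => h ε hε (L x) (Set.mem_image_of_mem L hx)⟩
  exact (h'.const_mul (pow_nonneg (norm_nonneg L) k)).le
    fun ε x hx => norm_iteratedFDeriv_comp_le hu L k ε (hL (hKΩ hx))

variable (Ω) in
/-- The algebra `E_M(Ω)` of moderate nets of smooth functions on `Ω`. -/
def moderate : Subalgebra ℂ (Net d) where
  carrier := {u | IsSmooth Ω u ∧ IsModerate Ω u}
  add_mem' hu hv := ⟨fun ε => (hu.1 ε).add (hv.1 ε), hu.2.add hu.1 hv.1 hv.2⟩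
  mul_mem' hu hv := ⟨fun ε => (hu.1 ε).mul (hv.1 ε), hu.2.mul hu.1 hv.1 hv.2⟩
  algebraMap_mem' c := ⟨fun _ => contDiffOn_const, IsModerate.const c⟩

variable (Ω) in
/-- The ideal `N(Ω)` of negligible nets in `E_M(Ω)`. -/
def negligible : Ideal (moderate Ω) where
  carrier := {u | IsNegligible Ω (u : Net d)}
  add_mem' {u v} hu hv := IsNegligible.add u.2.1 v.2.1 hu hv
  zero_mem' K _ _ k m := by
    refine SupIsBigO.zero.le fun ε x _ => ?_
    have : ((0 : moderate Ω) : Net d) ε = 0 := rfl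
    simp [this]
  smul_mem' c {u} hu := IsNegligible.mul c.2.1 u.2.1 c.2.2 hu

end

end Colombeau

/-- The special Colombeau algebra `G(Ω) = E_M(Ω) / N(Ω)` of an open set `Ω ⊆ ℝ^d`, a commutative
`ℂ`-algebra. Values of representatives outside `Ω` are irrelevant (`Colombeau.mk_eq_of_eqOn`). -/
abbrev Colombeau {d : ℕ} (Ω : TopologicalSpace.Opens (EuclideanSpace ℝ (Fin d))) : Type :=
  Colombeau.moderate Ω ⧸ Colombeau.negligible Ω

namespace Colombeau

section

variable {d : ℕ} {Ω Ω' : TopologicalSpace.Opens (EuclideanSpace ℝ (Fin d))}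

/-- Nets that agree on `Ω` define the same generalized function on `Ω`. -/
theorem mk_eq_of_eqOn (u v : moderate Ω)
    (h : ∀ ε, Set.EqOn ((u : Net d) ε) ((v : Net d) ε) Ω) :
    Ideal.Quotient.mk (negligible Ω) u = Ideal.Quotient.mk (negligible Ω) v := by
  rw [Ideal.Quotient.eq]
  intro K _ hKΩ k m
  refine SupIsBigO.zero.le fun ε x hx => ?_
  have h0 : ((u - v : moderate Ω) : Net d) ε =ᶠ[nhds x] fun _ => 0 := by
    filter_upwards [Ω.isOpen.mem_nhds (hKΩ hx)] with y hy
    exact sub_eq_zero.2 (h ε hy)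
  have h1 := (h0.iteratedFDeriv (𝕜 := ℝ) k).eq_of_nhds
  rw [h1]
  simp

/-- Composition of nets with a linear map `L : ℝ^d → ℝ^d` sending `Ω` into `Ω'`. -/
def compNet (L : EuclideanSpace ℝ (Fin d) →L[ℝ] EuclideanSpace ℝ (Fin d))
    (hL : Set.MapsTo L Ω Ω') : moderate Ω' →ₐ[ℂ] moderate Ω where
  toFun u := ⟨fun ε x => (u : Net d) ε (L x),
    IsSmooth.comp u.2.1 hL, IsModerate.comp u.2.1 u.2.2 hL⟩
  map_one' := rfl
  map_mul' _ _ := rfl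
  map_zero' := rfl
  map_add' _ _ := rfl
  commutes' _ := rfl

/-- The map `G(Ω') → G(Ω)`, `u ↦ u ∘ L`, for a linear map `L` sending `Ω` into `Ω'`; it is
`[(u_ε)] ↦ [(u_ε ∘ L)]` on representatives. -/
def comp (L : EuclideanSpace ℝ (Fin d) →L[ℝ] EuclideanSpace ℝ (Fin d))
    (hL : Set.MapsTo L Ω Ω') : Colombeau Ω' →ₐ[ℂ] Colombeau Ω :=
  Ideal.quotientMapₐ (negligible Ω) (compNet L hL) fun u hu => IsNegligible.comp u.2.1 hu hL

/-- The restriction map `G(Ω') → G(Ω)` for `Ω ⊆ Ω'`. -/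
def restrict (h : Ω ≤ Ω') : Colombeau Ω' →ₐ[ℂ] Colombeau Ω :=
  comp (ContinuousLinearMap.id ℝ _) fun _ hx => h hx

/-- `Ω` is stable under multiplication by positive real numbers. -/
def IsConic (Ω : TopologicalSpace.Opens (EuclideanSpace ℝ (Fin d))) : Prop :=
  ∀ lam : ℝ, 0 < lam → ∀ x ∈ Ω, lam • x ∈ Ω

/-- The generalized function `u(λ x)`, for a real number `λ > 0`. -/
def dilate (hΩ : IsConic Ω) {lam : ℝ} (hlam : 0 < lam) : Colombeau Ω →ₐ[ℂ] Colombeau Ω :=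
  comp (lam • ContinuousLinearMap.id ℝ _) fun x hx => hΩ lam hlam x hx

/-- `u ∈ G(Ω)` is homogeneous of degree `α`: for each `λ > 0`, `u(λ x) = λ^α u(x)` in `G(Ω)`. -/
def IsHomogeneous (hΩ : IsConic Ω) (α : ℝ) (u : Colombeau Ω) : Prop :=
  ∀ (lam : ℝ) (hlam : 0 < lam), dilate hΩ hlam u = ((lam ^ α : ℝ) : ℂ) • u

end

/-- The open set `ℝ^d ∖ {0}`. -/
def punctured (d : ℕ) : TopologicalSpace.Opens (EuclideanSpace ℝ (Fin d)) :=
  ⟨{0}ᶜ, isOpen_compl_singleton⟩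

theorem isConic_top (d : ℕ) :
    IsConic (⊤ : TopologicalSpace.Opens (EuclideanSpace ℝ (Fin d))) :=
  fun _ _ _ _ => trivial

theorem isConic_punctured (d : ℕ) : IsConic (punctured d) :=
  fun _ hlam _ hx => smul_ne_zero hlam.ne' hx

/-- `u ∈ G(ℝ^d ∖ {0})` is extendable: it is the restriction of some `û ∈ G(ℝ^d)`. -/
def IsExtendable {d : ℕ} (u : Colombeau (punctured d)) : Prop :=
  ∃ v : Colombeau (⊤ : TopologicalSpace.Opens (EuclideanSpace ℝ (Fin d))), restrict (Ω := punctured d) le_top v = u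

/-- `u ∈ G(ℝ^d ∖ {0})` is extendable as a homogeneous function: it is the restriction of some
`û ∈ G(ℝ^d)` that is homogeneous of some degree `β ∈ ℝ`. -/
def IsExtendableAsHomogeneous {d : ℕ} (u : Colombeau (punctured d)) : Prop :=
  ∃ β : ℝ, ∃ v : Colombeau (⊤ : TopologicalSpace.Opens (EuclideanSpace ℝ (Fin d))),
    IsHomogeneous (isConic_top d) β v ∧ restrict (Ω := punctured d) le_top v = u

end Colombeau

/-!
A single dilation suffices: let `u ≠ 0` satisfy `u(q x) = c u(x)` with `q > 1`; if `u` is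
homogeneous of degree `α`, this holds with `q = 2` and `c = 2 ^ α`.

*Extension.* A moderate net may blow up arbitrarily fast at the origin, so it cannot just be cut off
at scale `ε`. Instead, let `χ` be a cutoff function equal to `1` near `0` and put
`ψ(x) = χ(x) - χ(q x)`, which is supported in an annulus. Replacing `u(x)` by `c ^ (-k) u(q ^ k x)`
on the support of `ψ(q ^ k ·)` in the partition `1 = (1 - χ) + ∑ k, ψ(q ^ k ·)` of unity on
`ℝ^d ∖ {0}` leads to
`(1 - χ(x)) u_ε(x) + ∑ k < L(ε), c ^ (-k) ψ(q ^ k x) u_ε(q ^ k x)`,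
which only involves `u_ε` away from the origin. It is moderate on `ℝ^d` if `q ^ L(ε) ≤ 1 / ε`,
and it represents `u` on `ℝ^d ∖ {0}` if `L(ε) → ∞`, because only finitely many terms are
nonzero on a given compact set.

*Degree.* Let `v` on `ℝ^d` satisfy `v(q x) = c v(x)`. Differentiating `k` times gives
`q ^ k D^k v(q x) = c D^k v(x)`, so `D^k v` is negligible on balls when `q ^ k > ‖c‖`, and `D^k v(0)`
is negligible when `c ≠ q ^ k`. If `c` is no power of `q`, integrating downwards from a large order
shows that `v = 0`.
-/

namespace Colombeau

section IteratedFDeriv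

variable {E F : Type*} [NormedAddCommGroup E] [NormedSpace ℝ E] [NormedAddCommGroup F]
  [NormedSpace ℝ F] {f : E → F} {k : ℕ}

lemma iteratedFDeriv_comp_smul_sub_smul {R : Type*} [DistribSMul R F] [SMulCommClass ℝ R F]
    [ContinuousConstSMul R F] (hf : ContDiff ℝ k f) (a : ℝ) (c : R) (x : E) :
    iteratedFDeriv ℝ k (fun y => f (a • y) - c • f y) x =
      a ^ k • iteratedFDeriv ℝ k f (a • x) - c • iteratedFDeriv ℝ k f x := by
  have hcomp : ContDiff ℝ k fun y => f (a • y) := hf.comp (contDiff_const_smul a)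
  have hsmul : ContDiff ℝ k fun y => c • f y := hf.const_smul c
  rw [fun_iteratedFDeriv_sub_apply hcomp.contDiffAt hsmul.contDiffAt,
    iteratedFDeriv_comp_const_smul a hf, iteratedFDeriv_const_smul_apply' hf.contDiffAt]

lemma norm_iteratedFDeriv_le_of_norm_lt_pow [ProperSpace E] {𝕜 : Type*} [NormedField 𝕜]
    [NormedSpace 𝕜 F] [SMulCommClass ℝ 𝕜 F] (hf : ContDiff ℝ k f) {q : ℝ} (hq : 1 ≤ q) {c : 𝕜}
    (hc : ‖c‖ < q ^ k) {r B : ℝ}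
    (hB : ∀ z ∈ Metric.closedBall (0 : E) r,
      ‖iteratedFDeriv ℝ k (fun y => f (q • y) - c • f y) z‖ ≤ B)
    {x : E} (hx : x ∈ Metric.closedBall (0 : E) r) :
    ‖iteratedFDeriv ℝ k f x‖ ≤ B / (q ^ k - ‖c‖) := by
  have hq0 : 0 < q := one_pos.trans_le hq
  obtain ⟨y, hy, hmax⟩ := (isCompact_closedBall (0 : E) r).exists_isMaxOn ⟨x, hx⟩
    (hf.continuous_iteratedFDeriv le_rfl).norm.continuousOn
  refine (hmax hx).trans ((le_div_iff₀' (sub_pos.2 hc)).2 ?_)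
  -- The defect at `y / q` compares the maximum with a value inside the same ball.
  have hz : q⁻¹ • y ∈ Metric.closedBall (0 : E) r := by
    rw [mem_closedBall_zero_iff, norm_smul, Real.norm_of_nonneg (inv_nonneg.2 hq0.le)]
    exact (mul_le_of_le_one_left (norm_nonneg y) (inv_le_one_of_one_le₀ hq)).trans
      (mem_closedBall_zero_iff.1 hy)
  have hdefect := hB _ hz
  rw [iteratedFDeriv_comp_smul_sub_smul hf, smul_inv_smul₀ hq0.ne'] at hdefect
  have htriangle := (norm_sub_norm_le (q ^ k • iteratedFDeriv ℝ k f y)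
    (c • iteratedFDeriv ℝ k f (q⁻¹ • y))).trans hdefect
  rw [norm_smul, norm_smul, Real.norm_of_nonneg (pow_nonneg hq0.le k)] at htriangle
  have hle : ‖c‖ * ‖iteratedFDeriv ℝ k f (q⁻¹ • y)‖ ≤ ‖c‖ * ‖iteratedFDeriv ℝ k f y‖ :=
    mul_le_mul_of_nonneg_left (hmax hz) (norm_nonneg c)
  linarith

lemma norm_iteratedFDeriv_le_add_of_succ (hf : ContDiff ℝ (k + 1) f) {r B : ℝ}
    (hB : ∀ z ∈ Metric.closedBall (0 : E) r, ‖iteratedFDeriv ℝ (k + 1) f z‖ ≤ B)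
    {x : E} (hx : x ∈ Metric.closedBall (0 : E) r) :
    ‖iteratedFDeriv ℝ k f x‖ ≤ ‖iteratedFDeriv ℝ k f 0‖ + B * r := by
  have hxr : ‖x‖ ≤ r := mem_closedBall_zero_iff.1 hx
  have hmean : ‖iteratedFDeriv ℝ k f x - iteratedFDeriv ℝ k f 0‖ ≤ B * ‖x - 0‖ :=
    (convex_closedBall (0 : E) r).norm_image_sub_le_of_norm_fderiv_le (𝕜 := ℝ)
      (fun y _ => hf.differentiable_iteratedFDeriv (by exact_mod_cast k.lt_succ_self) y)
      (fun y hy => norm_fderiv_iteratedFDeriv.trans_le (hB y hy))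
      (Metric.mem_closedBall_self ((norm_nonneg x).trans hxr)) hx
  have hB0 : 0 ≤ B := (norm_nonneg _).trans (hB x hx)
  calc ‖iteratedFDeriv ℝ k f x‖
      ≤ ‖iteratedFDeriv ℝ k f 0‖ + ‖iteratedFDeriv ℝ k f x - iteratedFDeriv ℝ k f 0‖ :=
        norm_le_norm_add_norm_sub' _ _
    _ ≤ ‖iteratedFDeriv ℝ k f 0‖ + B * r := by
        rw [sub_zero] at hmean
        gcongr
        exact hmean.trans (mul_le_mul_of_nonneg_left hxr hB0)

end IteratedFDeriv

section Dilation

variable {d : ℕ} {Ω Ω' : TopologicalSpace.Opens (EuclideanSpace ℝ (Fin d))}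

/-- The net `u_ε(q x)`, for `q > 0`. It represents `dilate`, see `dilate_mk`. -/
def dilateNet (hΩ : IsConic Ω) {q : ℝ} (hq : 0 < q) : moderate Ω →ₐ[ℂ] moderate Ω :=
  compNet (q • ContinuousLinearMap.id ℝ _) fun x hx => hΩ q hq x hx

lemma dilate_mk (hΩ : IsConic Ω) {q : ℝ} (hq : 0 < q) (u : moderate Ω) :
    dilate hΩ hq (Ideal.Quotient.mk (negligible Ω) u) =
      Ideal.Quotient.mk (negligible Ω) (dilateNet hΩ hq u) := rfl

lemma dilateNet_apply (hΩ : IsConic Ω) {q : ℝ} (hq : 0 < q) (u : moderate Ω)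
    (ε : Set.Ioc (0 : ℝ) 1) (x : EuclideanSpace ℝ (Fin d)) :
    (dilateNet hΩ hq u : Net d) ε x = (u : Net d) ε (q • x) := rfl

lemma dilate_mk_eq_smul_iff (hΩ : IsConic Ω) {q : ℝ} (hq : 0 < q) (c : ℂ) (u : moderate Ω) :
    dilate hΩ hq (Ideal.Quotient.mk (negligible Ω) u) = c • Ideal.Quotient.mk (negligible Ω) u ↔
      dilateNet hΩ hq u - c • u ∈ negligible Ω :=
  Ideal.Quotient.eq (y := c • u)

lemma dilate_dilate (hΩ : IsConic Ω) {a b : ℝ} (ha : 0 < a) (hb : 0 < b) (u : Colombeau Ω) :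
    dilate hΩ ha (dilate hΩ hb u) = dilate hΩ (mul_pos ha hb) u := by
  obtain ⟨u, rfl⟩ := Ideal.Quotient.mk_surjective u
  simp only [dilate_mk]
  refine mk_eq_of_eqOn _ _ fun ε x _ => ?_
  simp only [dilateNet_apply, smul_smul, mul_comm]

lemma dilate_one (hΩ : IsConic Ω) (u : Colombeau Ω) : dilate hΩ one_pos u = u := by
  obtain ⟨u, rfl⟩ := Ideal.Quotient.mk_surjective u
  rw [dilate_mk]
  refine mk_eq_of_eqOn _ _ fun ε x _ => ?_
  rw [dilateNet_apply, one_smul]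

lemma dilate_injective (hΩ : IsConic Ω) {q : ℝ} (hq : 0 < q) :
    Function.Injective (dilate hΩ hq) := by
  refine Function.LeftInverse.injective (g := dilate hΩ (inv_pos.2 hq)) fun u => ?_
  rw [dilate_dilate]
  simp only [inv_mul_cancel₀ hq.ne', dilate_one]

lemma dilate_pow_eq_smul {hΩ : IsConic Ω} {q : ℝ} {hq : 0 < q} {c : ℂ} {u : Colombeau Ω}
    (hu : dilate hΩ hq u = c • u) (k : ℕ) : dilate hΩ (pow_pos hq k) u = c ^ k • u := by
  induction k with
  | zero => simpa only [pow_zero, one_smul] using dilate_one hΩ u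
  | succ k ih =>
    calc dilate hΩ (pow_pos hq (k + 1)) u = dilate hΩ (pow_pos hq k) (dilate hΩ hq u) :=
          (dilate_dilate hΩ (pow_pos hq k) hq u).symm
      _ = c ^ (k + 1) • u := by
          rw [hu, AlgHom.map_smul_of_tower, ih, smul_smul, pow_succ']

lemma restrict_dilate (hΩ : IsConic Ω) (hΩ' : IsConic Ω') (h : Ω ≤ Ω') {q : ℝ} (hq : 0 < q)
    (u : Colombeau Ω') : restrict h (dilate hΩ' hq u) = dilate hΩ hq (restrict h u) := by
  obtain ⟨u, rfl⟩ := Ideal.Quotient.mk_surjective u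
  rfl

lemma eq_of_dilate_eq_smul_of_restrict {hΩ : IsConic Ω} {hΩ' : IsConic Ω'}
    {h : Ω ≤ Ω'} {q : ℝ} {hq : 0 < q} {c c' : ℂ} {v : Colombeau Ω'} (hv : restrict h v ≠ 0)
    (hc : dilate hΩ hq (restrict h v) = c • restrict h v) (hc' : dilate hΩ' hq v = c' • v) :
    c = c' := by
  refine smul_left_injective ℂ hv ?_
  calc c • restrict h v = restrict h (dilate hΩ' hq v) := by rw [restrict_dilate hΩ hΩ', hc]
    _ = c' • restrict h v := by rw [hc', AlgHom.map_smul_of_tower]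

end Dilation

section Degree

variable {d : ℕ} {u : Net d} {q : ℝ} {c : ℂ}

lemma isNegligible_top_of_closedBall
    (h : ∀ (r : ℝ) (k m : ℕ), SupIsBigO (Metric.closedBall (0 : EuclideanSpace ℝ (Fin d)) r)
      (fun ε x => ‖iteratedFDeriv ℝ k (u ε) x‖) m) : IsNegligible ⊤ u := by
  intro K hK _ k m
  obtain ⟨r, hr⟩ := hK.isBounded.subset_closedBall 0
  obtain ⟨C, η, hη, hC⟩ := h r k m
  exact ⟨C, η, hη, fun ε hε x hx => hC ε hε x (hr hx)⟩

lemma supIsBigO_iteratedFDeriv_of_norm_lt_pow (hu : ∀ ε, ContDiff ℝ ∞ (u ε)) (hq : 1 ≤ q)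
    (h : IsNegligible ⊤ fun ε x => u ε (q • x) - c • u ε x) {k : ℕ} (hc : ‖c‖ < q ^ k) (r : ℝ)
    (m : ℕ) :
    SupIsBigO (Metric.closedBall (0 : EuclideanSpace ℝ (Fin d)) r)
      (fun ε x => ‖iteratedFDeriv ℝ k (u ε) x‖) m := by
  obtain ⟨C, η, hη, hC⟩ := h _ (isCompact_closedBall 0 r) (Set.subset_univ _) k m
  refine ⟨C / (q ^ k - ‖c‖), η, hη, fun ε hε x hx => ?_⟩
  rw [div_mul_eq_mul_div]
  exact norm_iteratedFDeriv_le_of_norm_lt_pow (contDiff_infty.1 (hu ε) k) hq hc (hC ε hε) hx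

lemma supIsBigO_iteratedFDeriv_zero_of_ne_pow (hu : ∀ ε, ContDiff ℝ ∞ (u ε))
    (h : IsNegligible ⊤ fun ε x => u ε (q • x) - c • u ε x) {k : ℕ} (hc : c ≠ q ^ k) (m : ℕ) :
    SupIsBigO {(0 : EuclideanSpace ℝ (Fin d))} (fun ε x => ‖iteratedFDeriv ℝ k (u ε) x‖) m := by
  have hpos : 0 < ‖(q ^ k - c : ℂ)‖ := norm_pos_iff.2 (sub_ne_zero.2 hc.symm)
  refine ((h {0} isCompact_singleton (Set.subset_univ _) k m).const_mul
    (inv_nonneg.2 hpos.le)).le ?_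
  rintro ε _ rfl
  have hfactor : iteratedFDeriv ℝ k (fun y => u ε (q • y) - c • u ε y) 0 =
      (q ^ k - c : ℂ) • iteratedFDeriv ℝ k (u ε) 0 := by
    rw [iteratedFDeriv_comp_smul_sub_smul (contDiff_infty.1 (hu ε) k), smul_zero, sub_smul,
      ← Complex.ofReal_pow, Complex.coe_smul]
  rw [hfactor, norm_smul, inv_mul_cancel_left₀ hpos.ne']

lemma supIsBigO_iteratedFDeriv_of_succ (hu : ∀ ε, ContDiff ℝ ∞ (u ε)) {r : ℝ} {k : ℕ} {m : ℤ}
    (h0 : SupIsBigO {(0 : EuclideanSpace ℝ (Fin d))} (fun ε x => ‖iteratedFDeriv ℝ k (u ε) x‖) m)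
    (hsucc : SupIsBigO (Metric.closedBall (0 : EuclideanSpace ℝ (Fin d)) r)
      (fun ε x => ‖iteratedFDeriv ℝ (k + 1) (u ε) x‖) m) :
    SupIsBigO (Metric.closedBall (0 : EuclideanSpace ℝ (Fin d)) r)
      (fun ε x => ‖iteratedFDeriv ℝ k (u ε) x‖) m := by
  obtain ⟨C, η, hη, hC⟩ := h0
  obtain ⟨C', η', hη', hC'⟩ := hsucc
  refine ⟨C + C' * r, min η η', lt_min hη hη', fun ε hε x hx => ?_⟩
  calc ‖iteratedFDeriv ℝ k (u ε) x‖
      ≤ ‖iteratedFDeriv ℝ k (u ε) 0‖ + C' * (ε : ℝ) ^ m * r :=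
        norm_iteratedFDeriv_le_add_of_succ (contDiff_infty.1 (hu ε) (k + 1))
          (hC' ε (hε.trans_le (min_le_right _ _))) hx
    _ ≤ C * (ε : ℝ) ^ m + C' * (ε : ℝ) ^ m * r :=
        add_le_add_left (hC ε (hε.trans_le (min_le_left _ _)) 0 rfl) _
    _ = (C + C' * r) * (ε : ℝ) ^ m := by ring

lemma isNegligible_top_of_ne_pow (hu : ∀ ε, ContDiff ℝ ∞ (u ε)) (hq : 1 < q)
    (h : IsNegligible ⊤ fun ε x => u ε (q • x) - c • u ε x) (hc : ∀ k : ℕ, c ≠ q ^ k) :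
    IsNegligible ⊤ u := by
  refine isNegligible_top_of_closedBall fun r k m => ?_
  obtain ⟨n, hn⟩ := pow_unbounded_of_one_lt ‖c‖ hq
  have hlarge : ∀ j, n ≤ j → ‖c‖ < q ^ j := fun j hj =>
    hn.trans_le (pow_le_pow_right₀ hq.le hj)
  rcases le_total n k with hnk | hkn
  · exact supIsBigO_iteratedFDeriv_of_norm_lt_pow hu hq.le h (hlarge k hnk) r m
  · induction hkn using Nat.decreasingInduction with
    | self => exact supIsBigO_iteratedFDeriv_of_norm_lt_pow hu hq.le h hn r m
    | of_succ j _ ih =>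
      exact supIsBigO_iteratedFDeriv_of_succ hu
        (supIsBigO_iteratedFDeriv_zero_of_ne_pow hu h (hc j) m) ih

theorem exists_eq_pow_of_dilate_eq_smul
    {v : Colombeau (⊤ : TopologicalSpace.Opens (EuclideanSpace ℝ (Fin d)))} (hv : v ≠ 0)
    (hq : 1 < q) (h : dilate (isConic_top d) (one_pos.trans hq) v = c • v) :
    ∃ n : ℕ, c = q ^ n := by
  by_contra! hc
  obtain ⟨v, rfl⟩ := Ideal.Quotient.mk_surjective v
  refine hv (Ideal.Quotient.eq_zero_iff_mem.2 ?_)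
  exact isNegligible_top_of_ne_pow (fun ε => contDiffOn_univ.1 (v.2.1 ε)) hq
    ((dilate_mk_eq_smul_iff _ _ _ _).1 h) hc

end Degree

section ModerateNets

variable {d : ℕ} {Ω : TopologicalSpace.Opens (EuclideanSpace ℝ (Fin d))}

lemma SupIsBigO.of_inter {X : Type*} {K S : Set X} {φ : Set.Ioc (0 : ℝ) 1 → X → ℝ} {m : ℤ}
    (h : SupIsBigO (K ∩ S) φ m) (h0 : ∀ ε, ∀ x ∈ K \ S, φ ε x ≤ 0) : SupIsBigO K φ m := by
  obtain ⟨C, η, hη, h⟩ := h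
  refine ⟨|C|, η, hη, fun ε hε x hx => ?_⟩
  have hpow : 0 ≤ (ε : ℝ) ^ m := (zpow_pos ε.2.1 m).le
  by_cases hxS : x ∈ S
  · exact (h ε hε x ⟨hx, hxS⟩).trans (mul_le_mul_of_nonneg_right (le_abs_self C) hpow)
  · exact (h0 ε x ⟨hx, hxS⟩).trans (mul_nonneg (abs_nonneg C) hpow)

lemma IsNegligible.of_eventuallyEq {u : Net d}
    (h : ∀ K : Set (EuclideanSpace ℝ (Fin d)), IsCompact K → K ⊆ Ω →
      ∃ w : Net d, IsNegligible Ω w ∧ ∃ η : ℝ, 0 < η ∧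
        ∀ ε : Set.Ioc (0 : ℝ) 1, (ε : ℝ) < η → ∀ x ∈ K, u ε =ᶠ[nhds x] w ε) :
    IsNegligible Ω u := by
  intro K hK hKΩ k m
  obtain ⟨w, hw, η, hη, huw⟩ := h K hK hKΩ
  obtain ⟨C, η', hη', hC⟩ := hw K hK hKΩ k m
  refine ⟨C, min η η', lt_min hη hη', fun ε hε x hx => ?_⟩
  have hderiv : iteratedFDeriv ℝ k (u ε) x = iteratedFDeriv ℝ k (w ε) x :=
    ((huw ε (hε.trans_le (min_le_left _ _)) x hx).iteratedFDeriv ℝ k).eq_of_nhds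
  exact (congrArg norm hderiv).trans_le (hC ε (hε.trans_le (min_le_right _ _)) x hx)

/-- The net with the constant value `f`, for a smooth function `f`. -/
def constNet {f : EuclideanSpace ℝ (Fin d) → ℂ} (hf : ContDiff ℝ ∞ f) : moderate Ω where
  val _ := f
  property := by
    refine ⟨fun _ => hf.contDiffOn, fun K hK _ k => ?_⟩
    obtain ⟨C, hC⟩ := hK.exists_bound_of_continuousOn
      ((contDiff_infty.1 hf k).continuous_iteratedFDeriv le_rfl).continuousOn
    exact ⟨0, C, 1, one_pos, fun ε _ x hx => by simpa using hC x hx⟩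

lemma mul_mem_moderate_top {f : EuclideanSpace ℝ (Fin d) → ℂ} (hf : ContDiff ℝ ∞ f)
    (hfΩ : tsupport f ⊆ Ω) (u : moderate Ω) :
    (fun ε x => f x * (u : Net d) ε x) ∈
      moderate (⊤ : TopologicalSpace.Opens (EuclideanSpace ℝ (Fin d))) := by
  obtain ⟨hsmooth, hmod⟩ := (constNet hf * u).2
  have hsupp : ∀ ε, tsupport (fun x => f x * (u : Net d) ε x) ⊆ tsupport f := fun ε =>
    tsupport_mul_subset_left
  constructor
  · refine fun ε x _ => ContDiffAt.contDiffWithinAt ?_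
    by_cases hx : x ∈ tsupport f
    · exact (hsmooth ε).contDiffAt (Ω.isOpen.mem_nhds (hfΩ hx))
    · exact contDiffAt_const.congr_of_eventuallyEq
        (notMem_tsupport_iff_eventuallyEq.1 fun h => hx (hsupp ε h))
  intro K hK _ k
  obtain ⟨N, hN⟩ := hmod (K ∩ tsupport f) (hK.inter_right (isClosed_tsupport f))
    (Set.inter_subset_right.trans hfΩ) k
  refine ⟨N, hN.of_inter fun ε x hx => ?_⟩
  have hx' : x ∉ Function.support (iteratedFDeriv ℝ k fun x => f x * (u : Net d) ε x) :=
    fun h => hx.2 (hsupp ε (support_iteratedFDeriv_subset k h))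
  exact (norm_eq_zero.2 (Function.notMem_support.1 hx')).le

lemma supIsBigO_univ_of_tsupport_subset {w : Net d} (hw : IsModerate ⊤ w)
    {K : Set (EuclideanSpace ℝ (Fin d))} (hK : IsCompact K) (hwK : ∀ ε, tsupport (w ε) ⊆ K)
    (k : ℕ) : ∃ N : ℕ, SupIsBigO Set.univ (fun ε x => ‖iteratedFDeriv ℝ k (w ε) x‖) (-(N : ℤ)) := by
  obtain ⟨N, hN⟩ := hw K hK (Set.subset_univ K) k
  refine ⟨N, SupIsBigO.of_inter (S := K) (by rwa [Set.univ_inter]) fun ε x hx => ?_⟩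
  have hx' : x ∉ Function.support (iteratedFDeriv ℝ k (w ε)) :=
    fun h => hx.2 (hwK ε (support_iteratedFDeriv_subset k h))
  exact (norm_eq_zero.2 (Function.notMem_support.1 hx')).le

end ModerateNets

section RescaledSum

variable {E F 𝕜 : Type*} [NormedAddCommGroup E] [NormedSpace ℝ E] [NormedAddCommGroup F]
  [NormedField 𝕜] [NormedSpace 𝕜 F] {q : ℝ} {c : 𝕜} {f : E → F}

/-- The sum of the first `n` rescalings `c ^ (-k) f(q ^ k x)` of `f`. Each of them agrees with `f`
if `f(q x) = c f(x)`. -/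
def rescaledSum (q : ℝ) (c : 𝕜) (n : ℕ) (f : E → F) (x : E) : F :=
  ∑ k ∈ Finset.range n, c⁻¹ ^ k • f (q ^ k • x)

lemma rescaledSum_eq_of_le {m n : ℕ} (hmn : m ≤ n) {x : E} (hx : ∀ k ≥ m, f (q ^ k • x) = 0) :
    rescaledSum q c n f x = rescaledSum q c m f x := by
  refine (Finset.sum_subset (Finset.range_mono hmn) fun k _ hk => ?_).symm
  rw [hx k (by simpa using hk), smul_zero]

lemma rescaledSum_one_sub_comp_smul (q : ℝ) (n : ℕ) (f : E → F) (x : E) :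
    rescaledSum q (1 : 𝕜) n (fun y => f y - f (q • y)) x = f x - f (q ^ n • x) := by
  simp only [rescaledSum, inv_one, one_pow, one_smul, smul_smul, ← pow_succ']
  simpa only [pow_zero, one_smul] using Finset.sum_range_sub' (fun k => f (q ^ k • x)) n

variable [NormedSpace ℝ F] [SMulCommClass ℝ 𝕜 F]

lemma contDiff_rescaledSum {k : ℕ∞} (hf : ContDiff ℝ k f) (q : ℝ) (c : 𝕜) (n : ℕ) :
    ContDiff ℝ k (rescaledSum q c n f) :=
  ContDiff.sum fun _ _ => (hf.comp (contDiff_const_smul _)).const_smul _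

lemma norm_iteratedFDeriv_rescaledSum_le {j : ℕ} (hf : ContDiff ℝ j f) (hq : 1 ≤ q) {M : ℕ}
    (hc : ‖c⁻¹‖ ≤ q ^ M) {A : ℝ} (hA : ∀ y, ‖iteratedFDeriv ℝ j f y‖ ≤ A) (n : ℕ) (x : E) :
    ‖iteratedFDeriv ℝ j (rescaledSum q c n f) x‖ ≤ n * ((q ^ n) ^ (M + j) * A) := by
  have hq0 : 0 ≤ q := zero_le_one.trans hq
  have hscale : ∀ k, ContDiff ℝ j fun y => f (q ^ k • y) := fun k =>
    hf.comp (contDiff_const_smul _)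
  have hterm : ∀ k ∈ Finset.range n,
      ‖iteratedFDeriv ℝ j (fun y => c⁻¹ ^ k • f (q ^ k • y)) x‖ ≤ (q ^ n) ^ (M + j) * A := by
    intro k hk
    have hkn : q ^ k ≤ q ^ n := pow_le_pow_right₀ hq (Finset.mem_range.1 hk).le
    have hck : ‖c⁻¹‖ ^ k ≤ (q ^ n) ^ M :=
      calc ‖c⁻¹‖ ^ k ≤ (q ^ M) ^ k := pow_le_pow_left₀ (norm_nonneg _) hc k
        _ = (q ^ k) ^ M := pow_right_comm _ _ _
        _ ≤ (q ^ n) ^ M := pow_le_pow_left₀ (pow_nonneg hq0 k) hkn M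
    rw [iteratedFDeriv_const_smul_apply' (hscale k).contDiffAt,
      iteratedFDeriv_comp_const_smul _ hf, norm_smul, norm_smul, norm_pow,
      Real.norm_of_nonneg (pow_nonneg (pow_nonneg hq0 k) j), ← mul_assoc, pow_add]
    gcongr
    exact hA _
  calc ‖iteratedFDeriv ℝ j (rescaledSum q c n f) x‖
      = ‖∑ k ∈ Finset.range n, iteratedFDeriv ℝ j (fun y => c⁻¹ ^ k • f (q ^ k • y)) x‖ :=
        congrArg norm (iteratedFDeriv_fun_sum_apply fun k _ =>
          ((hscale k).const_smul (c⁻¹ ^ k)).contDiffAt)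
    _ ≤ ∑ _k ∈ Finset.range n, (q ^ n) ^ (M + j) * A := norm_sum_le_of_le _ hterm
    _ = n * ((q ^ n) ^ (M + j) * A) := by
        rw [Finset.sum_const, Finset.card_range, nsmul_eq_mul]

end RescaledSum

section Extension

variable {d : ℕ} {q : ℝ} {c : ℂ}

lemma rescaledSum_mem_moderate_top (hq : 1 < q) {w : Net d} (hw : w ∈ moderate ⊤)
    {K : Set (EuclideanSpace ℝ (Fin d))} (hK : IsCompact K) (hwK : ∀ ε, tsupport (w ε) ⊆ K)
    {L : Set.Ioc (0 : ℝ) 1 → ℕ} (hL : ∀ ε, q ^ L ε ≤ (ε : ℝ)⁻¹) (c : ℂ) :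
    (fun ε => rescaledSum q c (L ε) (w ε)) ∈
      moderate (⊤ : TopologicalSpace.Opens (EuclideanSpace ℝ (Fin d))) := by
  have hwsmooth : ∀ ε, ContDiff ℝ ∞ (w ε) := fun ε => contDiffOn_univ.1 (hw.1 ε)
  refine ⟨fun ε => (contDiff_rescaledSum (hwsmooth ε) q c (L ε)).contDiffOn, fun _ _ _ j => ?_⟩
  obtain ⟨N, C, η, hη, hC⟩ := supIsBigO_univ_of_tsupport_subset hw.2 hK hwK j
  obtain ⟨M, hM⟩ := pow_unbounded_of_one_lt ‖c⁻¹‖ hq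
  refine ⟨1 + (M + j) + N, C / (q - 1), η, hη, fun ε hε x _ => ?_⟩
  have hε0 : (0 : ℝ) < ε := ε.2.1
  have hq0 : 0 < q := one_pos.trans hq
  have hdiv : q ^ L ε / (q - 1) ≤ (ε : ℝ)⁻¹ / (q - 1) :=
    div_le_div_of_nonneg_right (hL ε) (sub_pos.2 hq).le
  have hbound : ∀ y, ‖iteratedFDeriv ℝ j (w ε) y‖ ≤ C * (ε : ℝ) ^ (-(N : ℤ)) := fun y =>
    hC ε hε y (Set.mem_univ y)
  have hA : 0 ≤ C * (ε : ℝ) ^ (-(N : ℤ)) := (norm_nonneg _).trans (hbound x)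
  calc ‖iteratedFDeriv ℝ j (rescaledSum q c (L ε) (w ε)) x‖
      ≤ L ε * ((q ^ L ε) ^ (M + j) * (C * (ε : ℝ) ^ (-(N : ℤ)))) :=
        norm_iteratedFDeriv_rescaledSum_le (contDiff_infty.1 (hwsmooth ε) j) hq.le hM.le hbound _ _
    _ ≤ q ^ L ε / (q - 1) * ((q ^ L ε) ^ (M + j) * (C * (ε : ℝ) ^ (-(N : ℤ)))) :=
        mul_le_mul_of_nonneg_right (Nat.cast_le_pow_div_sub hq _)
          (mul_nonneg (pow_nonneg (pow_nonneg hq0.le _) _) hA)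
    _ ≤ (ε : ℝ)⁻¹ / (q - 1) * ((ε : ℝ)⁻¹ ^ (M + j) * (C * (ε : ℝ) ^ (-(N : ℤ)))) := by
        gcongr ?_ * (?_ ^ _ * _)
        exact hL ε
    _ = C / (q - 1) * (ε : ℝ) ^ (-((1 + (M + j) + N : ℕ) : ℤ)) := by
        simp only [zpow_neg, zpow_natCast, inv_pow, pow_add, mul_inv, pow_one]
        ring

lemma isNegligible_rescaledSum_sub {Ω : TopologicalSpace.Opens (EuclideanSpace ℝ (Fin d))}
    {hΩ : IsConic Ω} {hq : 0 < q} (hc : c ≠ 0) {ψ : EuclideanSpace ℝ (Fin d) → ℂ}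
    (hψ : ContDiff ℝ ∞ ψ) {u : moderate Ω}
    (hu : dilate hΩ hq (Ideal.Quotient.mk (negligible Ω) u) =
      c • Ideal.Quotient.mk (negligible Ω) u) (n : ℕ) :
    IsNegligible Ω fun ε x => rescaledSum q c n (fun y => ψ y * (u : Net d) ε y) x -
      rescaledSum q (1 : ℂ) n ψ x * (u : Net d) ε x := by
  have hmem : ∑ k ∈ Finset.range n,
      constNet ((hψ.comp (contDiff_const_smul (q ^ k))).const_smul (c⁻¹ ^ k)) *
        (dilateNet hΩ (pow_pos hq k) u - c ^ k • u) ∈ negligible Ω :=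
    Ideal.sum_mem _ fun k _ => Ideal.mul_mem_left _ _
      ((dilate_mk_eq_smul_iff _ _ _ _).1 (dilate_pow_eq_smul hu k))
  refine Eq.mp (congrArg (IsNegligible Ω) ?_) hmem
  funext ε x
  rw [AddSubmonoidClass.coe_finsetSum, Finset.sum_apply, Finset.sum_apply]
  simp only [rescaledSum, Finset.sum_mul, ← Finset.sum_sub_distrib]
  refine Finset.sum_congr rfl fun k _ => ?_
  change c⁻¹ ^ k * ψ (q ^ k • x) * ((u : Net d) ε (q ^ k • x) - c ^ k * (u : Net d) ε x) = _
  have hck : c⁻¹ ^ k * c ^ k = 1 := by rw [← mul_pow, inv_mul_cancel₀ hc, one_pow]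
  simp only [smul_eq_mul, inv_one, one_pow]
  linear_combination (-ψ (q ^ k • x) * (u : Net d) ε x) * hck

lemma exists_pow_le_inv_and_eventually_le (hq : 1 < q) :
    ∃ L : Set.Ioc (0 : ℝ) 1 → ℕ, (∀ ε, q ^ L ε ≤ (ε : ℝ)⁻¹) ∧
      ∀ n, ∃ η : ℝ, 0 < η ∧ ∀ ε : Set.Ioc (0 : ℝ) 1, (ε : ℝ) < η → n ≤ L ε := by
  choose L hL hlt using fun ε : Set.Ioc (0 : ℝ) 1 =>
    exists_nat_pow_near ((one_le_inv₀ ε.2.1).2 ε.2.2) hq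
  refine ⟨L, hL, fun n => ⟨(q ^ n)⁻¹, inv_pos.2 (pow_pos (one_pos.trans hq) n), fun ε hε => ?_⟩⟩
  have hpow : q ^ n < q ^ (L ε + 1) :=
    ((lt_inv_comm₀ ε.2.1 (pow_pos (one_pos.trans hq) n)).1 hε).trans (hlt ε)
  exact Nat.lt_succ_iff.1 ((pow_lt_pow_iff_right₀ hq).1 hpow)

lemma exists_forall_eventually_pow_smul_notMem {E : Type*} [NormedAddCommGroup E]
    [NormedSpace ℝ E] {S K : Set E} (hS : Bornology.IsBounded S) (hK : IsClosed K)
    (h0 : (0 : E) ∉ K) (hq : 1 < q) :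
    ∃ n : ℕ, ∀ x ∈ K, ∀ᶠ y in nhds x, ∀ k ≥ n, q ^ k • y ∉ S := by
  obtain ⟨R, hR⟩ := hS.exists_norm_le
  obtain ⟨r, hr, hball⟩ := Metric.isOpen_iff.1 hK.isOpen_compl 0 h0
  obtain ⟨n, hn⟩ := pow_unbounded_of_one_lt (R / (r / 2)) hq
  refine ⟨n, fun x hx => ?_⟩
  have hrx : r / 2 < ‖x‖ := by
    by_contra! hlt
    exact hball (mem_ball_zero_iff.2 (hlt.trans_lt (half_lt_self hr))) hx
  filter_upwards [continuous_norm.continuousAt.eventually (lt_mem_nhds hrx)] with y hy k hk hmem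
  have hnorm : ‖q ^ k • y‖ = q ^ k * ‖y‖ := by
    rw [norm_smul, Real.norm_of_nonneg (pow_nonneg (one_pos.trans hq).le k)]
  have hR' : R < q ^ k * ‖y‖ :=
    calc R < q ^ n * (r / 2) := (div_lt_iff₀ (half_pos hr)).1 hn
      _ ≤ q ^ k * ‖y‖ := by gcongr; exact hq.le
  exact (hR _ hmem).not_gt (hnorm ▸ hR')

lemma exists_contDiff_hasCompactSupport_eventuallyEq_one (E : Type*) [NormedAddCommGroup E]
    [NormedSpace ℝ E] [FiniteDimensional ℝ E] :
    ∃ χ : E → ℂ, ContDiff ℝ ∞ χ ∧ HasCompactSupport χ ∧ χ =ᶠ[nhds 0] 1 := by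
  let b : ContDiffBump (0 : E) := ⟨1, 2, one_pos, one_lt_two⟩
  refine ⟨fun x => (b x : ℂ), Complex.ofRealCLM.contDiff.comp b.contDiff,
    b.hasCompactSupport.comp_left Complex.ofReal_zero, ?_⟩
  filter_upwards [b.eventuallyEq_one] with x hx
  rw [hx, Pi.one_apply, Pi.one_apply, Complex.ofReal_one]

lemma tsupport_subset_punctured_iff {M : Type*} [Zero M] {f : EuclideanSpace ℝ (Fin d) → M} :
    tsupport f ⊆ punctured d ↔ f =ᶠ[nhds 0] 0 := by
  rw [← notMem_tsupport_iff_eventuallyEq]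
  exact Set.subset_compl_singleton_iff

lemma tsupport_sub_comp_smul_subset_punctured {M : Type*} [AddGroup M]
    {χ : EuclideanSpace ℝ (Fin d) → M} {a : M} (hχ : ∀ᶠ x in nhds 0, χ x = a) (q : ℝ) :
    tsupport (fun x => χ x - χ (q • x)) ⊆ punctured d := by
  refine tsupport_subset_punctured_iff.2 ?_
  have hχq : ∀ᶠ x in nhds (0 : EuclideanSpace ℝ (Fin d)), χ (q • x) = a :=
    ((continuous_const_smul q).tendsto' 0 0 (smul_zero q)).eventually hχ
  filter_upwards [hχ, hχq] with x hx hqx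
  rw [hx, hqx, sub_self, Pi.zero_apply]

lemma one_sub_mul_add_rescaledSum_sub {E : Type*} [NormedAddCommGroup E] [NormedSpace ℝ E]
    {χ f : E → ℂ} {n m : ℕ} (hnm : n ≤ m) {x : E} (hx : ∀ k ≥ n, χ (q ^ k • x) = 0) :
    (1 - χ x) * f x + rescaledSum q c m (fun y => (χ y - χ (q • y)) * f y) x - f x =
      rescaledSum q c n (fun y => (χ y - χ (q • y)) * f y) x -
        rescaledSum q (1 : ℂ) n (fun y => χ y - χ (q • y)) x * f x := by
  have hvanish : ∀ k ≥ n, (χ (q ^ k • x) - χ (q • q ^ k • x)) * f (q ^ k • x) = 0 := by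
    intro k hk
    rw [smul_smul, ← pow_succ', hx k hk, hx (k + 1) (hk.trans k.le_succ), sub_zero, zero_mul]
  rw [rescaledSum_eq_of_le hnm hvanish, rescaledSum_one_sub_comp_smul, hx n le_rfl]
  ring

theorem isExtendable_of_dilate_eq_smul (hq : 1 < q) (hc : c ≠ 0) {u : Colombeau (punctured d)}
    (hu : dilate (isConic_punctured d) (one_pos.trans hq) u = c • u) : IsExtendable u := by
  obtain ⟨u, rfl⟩ := Ideal.Quotient.mk_surjective u
  obtain ⟨χ, hχ, hχc, hχ1⟩ :=
    exists_contDiff_hasCompactSupport_eventuallyEq_one (EuclideanSpace ℝ (Fin d))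
  obtain ⟨L, hL, hLn⟩ := exists_pow_le_inv_and_eventually_le hq
  have hψ : ContDiff ℝ ∞ fun x => χ x - χ (q • x) := hχ.sub (hχ.comp (contDiff_const_smul q))
  have hψc : HasCompactSupport fun x => χ x - χ (q • x) :=
    hχc.comp₂_left (hχc.comp_smul (one_pos.trans hq).ne') (sub_zero 0)
  have hχ0 : tsupport (fun x => 1 - χ x) ⊆ punctured d :=
    tsupport_subset_punctured_iff.2 <| hχ1.mono fun x hx => sub_eq_zero.2 hx.symm
  have hfar := mul_mem_moderate_top (contDiff_const.sub hχ) hχ0 u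
  have hnear := rescaledSum_mem_moderate_top hq
    (mul_mem_moderate_top hψ (tsupport_sub_comp_smul_subset_punctured hχ1 q) u) hψc
    (fun ε => tsupport_mul_subset_left) hL c
  refine ⟨Ideal.Quotient.mk _ (⟨_, hfar⟩ + ⟨_, hnear⟩), Ideal.Quotient.eq.2 ?_⟩
  refine IsNegligible.of_eventuallyEq fun K hK hKΩ => ?_
  obtain ⟨n, hn⟩ := exists_forall_eventually_pow_smul_notMem hχc.isBounded hK.isClosed
    (Set.subset_compl_singleton_iff.1 hKΩ) hq
  obtain ⟨η, hη, hηL⟩ := hLn n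
  refine ⟨_, isNegligible_rescaledSum_sub hc hψ hu n, η, hη, fun ε hε x hx => ?_⟩
  filter_upwards [hn x hx] with y hy
  exact one_sub_mul_add_rescaledSum_sub (hηL ε hε) fun k hk =>
    image_eq_zero_of_notMem_tsupport (hy k hk)

end Extension

lemma exists_natCast_eq_of_ofReal_rpow_eq_pow {q α : ℝ} (hq : 1 < q)
    (h : ∃ n : ℕ, ((q ^ α : ℝ) : ℂ) = (q : ℂ) ^ n) : ∃ n : ℕ, α = n := by
  obtain ⟨n, hn⟩ := h
  have hreal : q ^ α = q ^ (n : ℝ) := by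
    rw [Real.rpow_natCast]
    exact_mod_cast hn
  exact ⟨n, (Real.rpow_right_inj (one_pos.trans hq) hq.ne').1 hreal⟩

end Colombeau

theorem mainTheorem5_general {d : ℕ} {q : ℝ} (hq : 1 < q) {c : ℂ}
    {u : Colombeau (Colombeau.punctured d)} (hu : u ≠ 0)
    (hc : Colombeau.dilate (Colombeau.isConic_punctured d) (one_pos.trans hq) u = c • u) :
    Colombeau.IsExtendable u ∧
      ∀ (c' : ℂ) (v : Colombeau (⊤ : TopologicalSpace.Opens (EuclideanSpace ℝ (Fin d)))),
        Colombeau.dilate (Colombeau.isConic_top d) (one_pos.trans hq) v = c' • v →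
        Colombeau.restrict (Ω := Colombeau.punctured d) le_top v = u → ∃ n : ℕ, c = q ^ n := by
  have hc0 : c ≠ 0 := by
    rintro rfl
    exact hu (Colombeau.dilate_injective _ _ (by rw [hc, zero_smul, map_zero]))
  refine ⟨Colombeau.isExtendable_of_dilate_eq_smul hq hc0 hc, ?_⟩
  rintro c' v hv rfl
  obtain rfl : c = c' := Colombeau.eq_of_dilate_eq_smul_of_restrict hu hc hv
  refine Colombeau.exists_eq_pow_of_dilate_eq_smul (fun hv0 => hu ?_) hq hv
  rw [hv0, map_zero]

theorem mainTheorem5 (d : ℕ) (hd : 1 ≤ d) (α : ℝ) (u : Colombeau (Colombeau.punctured d))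
    (hu : u ≠ 0) (hα : Colombeau.IsHomogeneous (Colombeau.isConic_punctured d) α u) :
    Colombeau.IsExtendable u ∧
      (Colombeau.IsExtendableAsHomogeneous u → ∃ n : ℕ, α = n) :=
  (mainTheorem5_general one_lt_two hu (hα 2 two_pos)).imp_right fun h ⟨_, v, hv, hvu⟩ =>
    Colombeau.exists_natCast_eq_of_ofReal_rpow_eq_pow one_lt_two (h _ v (hv 2 two_pos) hvu)
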